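/- Let $\tau$ be a countable relational signature and let $X_\tau=\prod_{R\in\tau}2^{\mathbb{N}^{a(R)}}$ be the space of $\tau$-structures with universe $\mathbb{N}$, where $a(R)$ is the arity of $R$. The group $S_\infty$ of permutations of $\mathbb{N}$, with the topology of pointwise convergence, acts on $X_\tau$: $R^{g(M)}(x)$ holds if and only if $R^M(g^{-1}(x))$ holds. Let $G\leq S_\infty$ be a closed subgroup and let $\mathcal{F}$ be the family of all orbits $\mathrm{Orb}_G(a)=\{g(a):g\in G\}$ of finite tuples $a\in\mathbb{N}^{<\omega}$. Let $\mathscr{L}_{\omega_1\omega}(\mathcal{F})$ be the infinitary logic $\mathscr{L}_{\omega_1\omega}$ (with equality, countable conjunctions and disjunctions, and finite strings of quantifiers) in the signature $\tau$ expanded by a symbol for each relation in $\mathcal{F}$, which is always interpreted on $\mathbb{N}$ as this relation. Then there is an assignment of an $\mathscr{L}_{\omega_1\omega}(\mathcal{F})$-sentence $\varphi^G_M$ to each $M\in X_\tau$ such that for all $M,N\in X_\tau$: 1. $M\vDash\varphi^G_M$; 2. $\varphi^G_M=\varphi^G_N$ (the same sentence) if and only if there is $g\in G$ with $g(M)=N$;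 3. $N\vDash\varphi^G_M$ if and only if there is $g\in G$ with $g(M)=N$, i.e. $\varphi^G_M$ is a $G$-relative Scott sentence of $M$: it defines the $G$-orbit of $M$ in $X_\tau$. -/

import Mathlib

open FirstOrder Topology

/-- Formulas of the infinitary logic `L_{ω₁ω}` over the first-order language `L` (with equality)
whose free variables are among `x₀, …, x_{n-1}`: countable conjunctions and disjunctions and
finite strings of quantifiers. A quantifier binds the last variable. Finite nonempty conjunctions
are obtained by repeating a conjunct, the empty one as `neg falsum`. -/
inductive InfFormula (L : Language) : ℕ → Type _
  | falsum {n : ℕ} : InfFormula L n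
  | equal {n : ℕ} (s t : L.Term (Fin n)) : InfFormula L n
  | rel {n k : ℕ} (R : L.Relations k) (ts : Fin k → L.Term (Fin n)) : InfFormula L n
  | neg {n : ℕ} (φ : InfFormula L n) : InfFormula L n
  | conj {n : ℕ} (φ : ℕ → InfFormula L n) : InfFormula L n
  | disj {n : ℕ} (φ : ℕ → InfFormula L n) : InfFormula L n
  | all {n : ℕ} (φ : InfFormula L (n + 1)) : InfFormula L n
  | ex {n : ℕ} (φ : InfFormula L (n + 1)) : InfFormula L n

/-- Satisfaction of an `L_{ω₁ω}`-formula in a structure under an assignment `v` of its free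
variables. -/
def InfFormula.Realize {L : Language} {A : Type*} [L.Structure A] :
    {n : ℕ} → InfFormula L n → (Fin n → A) → Prop
  | _, .falsum, _ => False
  | _, .equal s t, v => s.realize v = t.realize v
  | _, .rel R ts, v => Language.Structure.RelMap R fun i => (ts i).realize v
  | _, .neg φ, v => ¬ φ.Realize v
  | _, .conj φ, v => ∀ i, (φ i).Realize v
  | _, .disj φ, v => ∃ i, (φ i).Realize v
  | _, .all φ, v => ∀ a : A, φ.Realize (Fin.snoc v a)
  | _, .ex φ, v => ∃ a : A, φ.Realize (Fin.snoc v a)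

/-- The language with one `n`-ary relation symbol for each `n`-ary relation on `ℕ` in the
family `F`. -/
def familyLanguage (F : (n : ℕ) → Set (Set (Fin n → ℕ))) : Language where
  Functions := fun _ => Empty
  Relations := fun n => F n

/-- The fixed interpretation: each relation of the family `F` is named by its own symbol. -/
@[reducible] def familyStructure (F : (n : ℕ) → Set (Set (Fin n → ℕ))) : (familyLanguage F).Structure ℕ where
  funMap := fun f _ => f.elim
  RelMap := fun R x => x ∈ R.1

/-- The sentences of `L_{ω₁ω}(F)` in the signature `τ`. -/
abbrev FamilySentence (τ : Language) (F : (n : ℕ) → Set (Set (Fin n → ℕ))) :=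
  InfFormula (τ.sum (familyLanguage F)) 0

/-- `M ⊨ φ` for a `τ`-structure `M` on `ℕ` and an `L_{ω₁ω}(F)`-sentence `φ`: the symbols of `τ`
are interpreted as in `M`, the symbols of the relations in `F` as these relations. -/
def FamilySentence.Holds {τ : Language} {F : (n : ℕ) → Set (Set (Fin n → ℕ))}
    (M : τ.Structure ℕ) (φ : FamilySentence τ F) : Prop :=
  letI := M
  letI := familyStructure F
  InfFormula.Realize (A := ℕ) φ Fin.elim0

/-- The `G`-orbit `{g(a) : g ∈ G}` of a finite tuple `a` of natural numbers. -/
def tupleOrbit (G : Subgroup (Equiv.Perm ℕ)) {n : ℕ} (a : Fin n → ℕ) : Set (Fin n → ℕ) :=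
  {b | ∃ g ∈ G, (fun i => g (a i)) = b}

/-- The family of all `G`-orbits of finite tuples of natural numbers. -/
def orbitFamily (G : Subgroup (Equiv.Perm ℕ)) (n : ℕ) : Set (Set (Fin n → ℕ)) :=
  {S | ∃ a : Fin n → ℕ, S = tupleOrbit G a}

/-- The topology of `S_∞` as a subspace of the Baire space `ℕ → ℕ` (`ℕ` discrete). -/
@[reducible] def permTopology : TopologicalSpace (Equiv.Perm ℕ) :=
  TopologicalSpace.induced (fun g : Equiv.Perm ℕ => (g : ℕ → ℕ)) inferInstance

/-- The image `g(M)` of a structure `M` on `ℕ` under a permutation `g`: a relation holds of `x`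
in `g(M)` if and only if it holds of `g⁻¹(x)` in `M`. -/
@[reducible] def imageStructure {τ : Language} (g : Equiv.Perm ℕ) (M : τ.Structure ℕ) : τ.Structure ℕ :=
  letI := M
  Equiv.inducedStructure g

/-! Expand each structure by the `G`-orbits of finite tuples. A permutation preserving all these
orbits agrees with members of `G` on every finite set, so it lies in `G` because `G` is closed.
Hence isomorphisms of expansions are exactly the isomorphisms belonging to `G`, and the Scott
sentence of the expansion, whose language is still countable, defines the `G`-orbit
(`nonempty_equiv_orbitExpansion_iff`, `realize_scottSentence_iff_nonempty_equiv`).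

Scott's theorem is proved without ordinal ranks: a countable structure has only countably many
tuples to tell apart, so one formula isolates each full type, and the Scott sentence says that these
formulas form a back-and-forth system. -/

namespace InfFormula

open FirstOrder.Language

/-! ### Derived connectives -/

section Connectives

variable {L : Language} {n : ℕ} {A : Type*} [L.Structure A]

/-- Conjunction over a countable index type. -/
noncomputable def countableConj {ι : Type*} [Countable ι] (f : ι → InfFormula L n) :
    InfFormula L n :=
  letI := Encodable.ofCountable ι
  -- Numbers coding no index contribute a true conjunct.
  .conj fun k => ((Encodable.decode k : Option ι).map f).getD (.neg .falsum)

/-- Disjunction over a countable index type. -/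
noncomputable def countableDisj {ι : Type*} [Countable ι] (f : ι → InfFormula L n) :
    InfFormula L n :=
  .neg (countableConj fun i => .neg (f i))

/-- Conjunction of two formulas. -/
def and (φ ψ : InfFormula L n) : InfFormula L n :=
  .conj fun k => if k = 0 then φ else ψ

/-- Implication. -/
def imp (φ ψ : InfFormula L n) : InfFormula L n :=
  .neg (φ.and (.neg ψ))

/-- Universal closure. -/
def closure : {n : ℕ} → InfFormula L n → InfFormula L 0
  | 0, φ => φ
  | _ + 1, φ => closure (.all φ)

@[simp]
theorem realize_countableConj {ι : Type*} [Countable ι] (f : ι → InfFormula L n)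
    (v : Fin n → A) : (countableConj f).Realize v ↔ ∀ i, (f i).Realize v := by
  let := Encodable.ofCountable ι
  change (∀ k, InfFormula.Realize (((Encodable.decode k : Option ι).map f).getD _) v) ↔ _
  constructor
  · intro h i
    simpa using h (Encodable.encode i)
  · intro h k
    cases hk : (Encodable.decode k : Option ι) with
    | none => simp [Realize]
    | some i => simpa using h i

@[simp]
theorem realize_countableDisj {ι : Type*} [Countable ι] (f : ι → InfFormula L n)
    (v : Fin n → A) : (countableDisj f).Realize v ↔ ∃ i, (f i).Realize v := by
  simp [countableDisj, Realize]

@[simp]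
theorem realize_and (φ ψ : InfFormula L n) (v : Fin n → A) :
    (φ.and ψ).Realize v ↔ φ.Realize v ∧ ψ.Realize v := by
  simp only [and, Realize]
  refine ⟨fun h => ⟨by simpa using h 0, by simpa using h 1⟩, fun h k => ?_⟩
  split_ifs
  exacts [h.1, h.2]

@[simp]
theorem realize_imp (φ ψ : InfFormula L n) (v : Fin n → A) :
    (φ.imp ψ).Realize v ↔ (φ.Realize v → ψ.Realize v) := by
  simp [imp, Realize]

theorem realize_closure : ∀ {n : ℕ} (φ : InfFormula L n) (w : Fin 0 → A),
    φ.closure.Realize w ↔ ∀ v : Fin n → A, φ.Realize v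
  | 0, φ, w => ⟨fun h v => Subsingleton.elim w v ▸ h, fun h => h w⟩
  | n + 1, φ, w => by
    rw [closure, realize_closure]
    simp only [Realize]
    exact ⟨fun h v => by simpa using h (Fin.init v) (v (Fin.last n)), fun h v a => h _⟩

end Connectives

/-! ### Isomorphism invariance -/

section Invariance

variable {L : Language} {A B : Type*} [L.Structure A] [L.Structure B]

/-- Satisfaction is invariant under isomorphism. -/
theorem realize_comp_equiv (e : A ≃[L] B) {n : ℕ} (φ : InfFormula L n) :
    ∀ v : Fin n → A, φ.Realize (e ∘ v) ↔ φ.Realize v := by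
  induction φ with
  | falsum => exact fun _ => Iff.rfl
  | equal s t =>
    intro v
    simp only [Realize, HomClass.realize_term]
    exact e.injective.eq_iff
  | rel R ts =>
    intro v
    simp only [Realize, HomClass.realize_term]
    exact e.map_rel R fun i => (ts i).realize v
  | neg φ ih => exact fun v => not_congr (ih v)
  | conj φ ih => exact fun v => forall_congr' fun i => ih i v
  | disj φ ih => exact fun v => exists_congr fun i => ih i v
  | all φ ih =>
    intro v
    simp only [Realize]
    rw [← e.toEquiv.forall_congr_right]
    refine forall_congr' fun a => ?_
    rw [← ih, Fin.comp_snoc]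
    rfl
  | ex φ ih =>
    intro v
    simp only [Realize]
    rw [← e.toEquiv.exists_congr_right]
    refine exists_congr fun a => ?_
    rw [← ih, Fin.comp_snoc]
    rfl

end Invariance

/-! ### Isolated types and Scott sentences -/

section Scott

variable {L : Language} {A : Type*} [L.Structure A]

/-- The atomic formula saying that two given variables are equal, or that a relation holds of
given variables. -/
def atom {n : ℕ} : (Fin n × Fin n) ⊕ (Σ R : (Σ k, L.Relations k), Fin R.1 → Fin n) →
    InfFormula L n
  | .inl p => .equal (.var p.1) (.var p.2)
  | .inr p => .rel p.1.2 fun i => .var (p.2 i)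

/-- The conjunction of the relational atomic formulas and negated atomic formulas true of `a`. -/
noncomputable def diagram [Countable (Σ k, L.Relations k)] {n : ℕ} (a : Fin n → A) :
    InfFormula L n :=
  open Classical in
  countableConj fun t => if (atom (L := L) t).Realize a then atom t else .neg (atom t)

theorem realize_diagram {B : Type*} [L.Structure B] [Countable (Σ k, L.Relations k)] {n : ℕ}
    (a : Fin n → A) (b : Fin n → B) :
    (diagram (L := L) a).Realize b ↔
      ∀ t, (atom (L := L) t).Realize a ↔ (atom (L := L) t).Realize b := by
  rw [diagram, realize_countableConj]
  refine forall_congr' fun t => ?_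
  split_ifs with h <;> simp [Realize, h]

/-- In a countable structure every complete type of a tuple is isolated by a single formula. -/
theorem exists_isolating (L : Language) {A : Type*} [L.Structure A] [Countable A] {n : ℕ}
    (a : Fin n → A) : ∃ θ : InfFormula L n, ∀ b : Fin n → A,
      θ.Realize b ↔ ∀ ψ : InfFormula L n, ψ.Realize a ↔ ψ.Realize b := by
  -- There may be uncountably many formulas, but one separating formula per tuple `b` suffices, and
  -- there are countably many tuples.
  have key : ∀ b : Fin n → A, ∃ δ : InfFormula L n, δ.Realize a ∧
      (δ.Realize b → ∀ ψ : InfFormula L n, ψ.Realize a ↔ ψ.Realize b) := by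
    intro b
    by_cases h : ∀ ψ : InfFormula L n, ψ.Realize a ↔ ψ.Realize b
    · exact ⟨.neg .falsum, id, fun _ => h⟩
    · push Not at h
      obtain ⟨ψ, ⟨ha, hb⟩ | ⟨ha, hb⟩⟩ := h
      · exact ⟨ψ, ha, fun h => absurd h hb⟩
      · exact ⟨.neg ψ, ha, fun h => absurd hb h⟩
  choose δ hδ hδ' using key
  refine ⟨countableConj δ, fun b => ?_⟩
  rw [realize_countableConj]
  refine ⟨fun h => hδ' b (h b), fun h c => (h _).1 (hδ c)⟩

/-- A formula isolating the complete type of the tuple `a`. -/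
noncomputable def isolating (L : Language) {A : Type*} [L.Structure A] [Countable A] {n : ℕ}
    (a : Fin n → A) : InfFormula L n :=
  (exists_isolating L a).choose

theorem realize_isolating [Countable A] {n : ℕ} {a b : Fin n → A} :
    (isolating L a).Realize b ↔ ∀ ψ : InfFormula L n, ψ.Realize a ↔ ψ.Realize b :=
  (exists_isolating L a).choose_spec b

variable (L A) in
/-- The Scott sentence of a countable structure: tuples satisfying the formula isolating a type
have the same diagram and the same one-point extensions. -/
noncomputable def scottSentence [Countable A] [Countable (Σ k, L.Relations k)] : InfFormula L 0 :=
  (isolating L (Fin.elim0 : Fin 0 → A)).and <|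
    countableConj fun a : (Σ n, Fin n → A) =>
      closure <| (isolating L a.2).imp <| (diagram a.2).and <|
        and (.all (countableDisj fun c : A =>
            isolating L (Fin.snoc a.2 c : Fin (a.1 + 1) → A)))
          (countableConj fun c : A => .ex (isolating L (Fin.snoc a.2 c : Fin (a.1 + 1) → A)))

theorem realize_scottSentence [Countable A] [Countable (Σ k, L.Relations k)]
    {B : Type*} [L.Structure B] (w : Fin 0 → B) :
    (scottSentence L A).Realize w ↔
      (isolating L (Fin.elim0 : Fin 0 → A)).Realize w ∧
      ∀ (n : ℕ) (a : Fin n → A) (b : Fin n → B), (isolating L a).Realize b →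
        (∀ t, (atom (L := L) t).Realize a ↔ (atom (L := L) t).Realize b) ∧
        (∀ d : B, ∃ c : A,
          (isolating L (Fin.snoc a c : Fin (n + 1) → A)).Realize (Fin.snoc b d)) ∧
        ∀ c : A, ∃ d : B,
          (isolating L (Fin.snoc a c : Fin (n + 1) → A)).Realize (Fin.snoc b d) := by
  simp [scottSentence, realize_closure, realize_diagram, Realize, Sigma.forall]

theorem realize_scottSentence_self [Countable A] [Countable (Σ k, L.Relations k)]
    (w : Fin 0 → A) : (scottSentence L A).Realize w := by
  rw [realize_scottSentence]
  refine ⟨realize_isolating.2 fun ψ => by rw [Subsingleton.elim w Fin.elim0], ?_⟩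
  intro n a b hab
  rw [realize_isolating] at hab
  refine ⟨fun t => hab _, fun d => ?_, fun c => ?_⟩
  -- Existence of an extension realizing the type of `(b, d)` is part of the type of `b`, hence of
  -- that of `a`.
  · obtain ⟨c, hc⟩ := (hab (.ex (isolating L (Fin.snoc b d : Fin (n + 1) → A)))).2
      ⟨d, realize_isolating.2 fun _ => Iff.rfl⟩
    exact ⟨c, realize_isolating.2 fun ψ => (realize_isolating.1 hc ψ).symm⟩
  · exact (hab (.ex (isolating L (Fin.snoc a c : Fin (n + 1) → A)))).1
      ⟨c, realize_isolating.2 fun _ => Iff.rfl⟩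

end Scott

end InfFormula

/-! ### Back-and-forth and Scott's isomorphism theorem -/

section BackAndForth

/-- A back-and-forth system between countable nonempty types contains all finite parts of a pair
of simultaneous enumerations. -/
theorem exists_enumerations_of_backAndForth {A B : Type*} [Countable A] [Countable B] [Nonempty A]
    [Nonempty B] (P : (n : ℕ) → (Fin n → A) → (Fin n → B) → Prop)
    (h0 : P 0 Fin.elim0 Fin.elim0)
    (forth : ∀ n a b, P n a b → ∀ c, ∃ d, P (n + 1) (Fin.snoc a c) (Fin.snoc b d))
    (back : ∀ n a b, P n a b → ∀ d, ∃ c, P (n + 1) (Fin.snoc a c) (Fin.snoc b d)) :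
    ∃ (a : ℕ → A) (b : ℕ → B), a.Surjective ∧ b.Surjective ∧
      ∀ n, P n (fun i => a i) (fun i => b i) := by
  obtain ⟨eA, hA⟩ := exists_surjective_nat A
  obtain ⟨eB, hB⟩ := exists_surjective_nat B
  -- Even stages exhaust `A` by going forth, odd stages exhaust `B` by going back.
  have step : ∀ n a b, P n a b → ∃ p : A × B, P (n + 1) (Fin.snoc a p.1) (Fin.snoc b p.2) ∧
      (∀ k, n = 2 * k → p.1 = eA k) ∧ ∀ k, n = 2 * k + 1 → p.2 = eB k := by
    intro n a b h
    obtain ⟨k, hk⟩ := Nat.even_or_odd' n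
    rcases hk with hk | hk
    · obtain ⟨d, hd⟩ := forth n a b h (eA k)
      refine ⟨(eA k, d), hd, fun j hj => ?_, fun j hj => by omega⟩
      rw [show k = j by omega]
    · obtain ⟨c, hc⟩ := back n a b h (eB k)
      refine ⟨(c, eB k), hc, fun j hj => by omega, fun j hj => ?_⟩
      rw [show k = j by omega]
  choose f hf hfA hfB using step
  let s : (n : ℕ) → {p : (Fin n → A) × (Fin n → B) // P n p.1 p.2} := fun n =>
    Nat.rec ⟨(Fin.elim0, Fin.elim0), h0⟩
      (fun n p => ⟨(Fin.snoc p.1.1 (f n _ _ p.2).1, Fin.snoc p.1.2 (f n _ _ p.2).2),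
        hf n _ _ p.2⟩) n
  let x : ℕ → A × B := fun n => f n _ _ (s n).2
  have hs : ∀ n, (s n).1 = (fun i : Fin n => (x i).1, fun i : Fin n => (x i).2) := by
    intro n
    induction n with
    | zero => exact Prod.ext (Subsingleton.elim _ _) (Subsingleton.elim _ _)
    | succ n ih =>
      change ((Fin.snoc (s n).1.1 (x n).1 : Fin (n + 1) → A),
        (Fin.snoc (s n).1.2 (x n).2 : Fin (n + 1) → B)) = _
      rw [ih]
      refine Prod.ext (funext fun i => ?_) (funext fun i => ?_) <;>
        refine Fin.lastCases ?_ (fun i => ?_) i <;> simp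
  refine ⟨fun n => (x n).1, fun n => (x n).2, fun c => ?_, fun d => ?_, fun n => ?_⟩
  · obtain ⟨k, rfl⟩ := hA c
    exact ⟨2 * k, hfA _ _ _ _ k rfl⟩
  · obtain ⟨k, rfl⟩ := hB d
    exact ⟨2 * k + 1, hfB _ _ _ _ k rfl⟩
  · have := (s n).2
    rw [hs] at this
    exact this

/-- Two enumerations with the same equalities induce a bijection. -/
theorem exists_equiv_of_enumerations {I A B : Type*} {a : I → A} {b : I → B}
    (ha : a.Surjective) (hb : b.Surjective) (h : ∀ i j, a i = a j ↔ b i = b j) :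
    ∃ e : A ≃ B, ∀ i, e (a i) = b i := by
  refine ⟨Equiv.ofBijective (fun x => b (Function.surjInv ha x)) ⟨fun x y hxy => ?_, fun y => ?_⟩,
    fun i => ?_⟩
  · have := (h _ _).2 hxy
    rwa [Function.surjInv_eq ha, Function.surjInv_eq ha] at this
  · obtain ⟨i, rfl⟩ := hb y
    exact ⟨a i, (h _ _).1 (Function.surjInv_eq ha _)⟩
  · exact (h _ _).1 (Function.surjInv_eq ha _)

end BackAndForth

/-- **Scott's isomorphism theorem** for countable structures in a countable relational language. -/
theorem InfFormula.realize_scottSentence_iff_nonempty_equiv {L : Language} [L.IsRelational]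
    [Countable (Σ k, L.Relations k)] {A B : Type*} [L.Structure A] [L.Structure B] [Countable A]
    [Countable B] [Nonempty A] [Nonempty B] (w : Fin 0 → B) :
    (scottSentence L A).Realize w ↔ Nonempty (A ≃[L] B) := by
  constructor
  · intro h
    obtain ⟨h0, h⟩ := (realize_scottSentence w).1 h
    obtain ⟨a, b, ha, hb, hab⟩ := exists_enumerations_of_backAndForth
      (fun n (a : Fin n → A) (b : Fin n → B) => (isolating L a).Realize b)
      (by rwa [Subsingleton.elim w Fin.elim0] at h0)
      (fun n a b hab => (h n a b hab).2.2) (fun n a b hab => (h n a b hab).2.1)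
    have hatom := fun n => (h n _ _ (hab n)).1
    -- Stage `max i j + 1` contains both entries, so its equality atoms compare them.
    obtain ⟨e, he⟩ := exists_equiv_of_enumerations ha hb fun i j =>
      by simpa [atom, Realize] using
        hatom (max i j + 1) (.inl (⟨i, by omega⟩, ⟨j, by omega⟩))
    refine ⟨⟨e, fun f => isEmptyElim f, fun {k} R x => ?_⟩⟩
    choose i hi using fun j => ha (x j)
    obtain rfl : (fun j => a (i j)) = x := funext hi
    -- A relation has finitely many arguments, so a single finite stage contains them all.
    obtain ⟨m, hm⟩ := (Set.finite_range i).bddAbove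
    have := hatom (m + 1) (.inr ⟨⟨k, R⟩, fun j => ⟨i j, Nat.lt_succ_of_le (hm ⟨j, rfl⟩)⟩⟩)
    simp only [atom, Realize, Language.Term.realize_var] at this
    rw [this]
    simp only [Function.comp_def, Equiv.toFun_as_coe, he]
  · rintro ⟨e⟩
    have := (realize_comp_equiv e (scottSentence L A) Fin.elim0).2 (realize_scottSentence_self _)
    rwa [Subsingleton.elim w]

/-! ### Relativization to a closed group -/

section Relative

variable {τ : Language} {G : Subgroup (Equiv.Perm ℕ)}

instance countable_orbitFamily (n : ℕ) : Countable (orbitFamily G n) := by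
  have : orbitFamily G n = Set.range fun a : Fin n → ℕ => tupleOrbit G a := by
    ext S
    exact exists_congr fun a => eq_comm
  rw [this]
  exact (Set.countable_range _).to_subtype

instance countable_sum_familyLanguage_relations [Countable τ.Symbols] :
    Countable (Σ k, (τ.sum (familyLanguage (orbitFamily G))).Relations k) := by
  have h1 : Countable (Σ k, τ.Relations k) :=
    (Sum.inr_injective (α := Σ k, τ.Functions k)).countable
  have h2 : ∀ k, Countable (τ.Relations k) := fun k =>
    (sigma_mk_injective (i := k) (β := fun k => τ.Relations k)).countable
  have h3 : ∀ k, Countable ((τ.sum (familyLanguage (orbitFamily G))).Relations k) := fun k =>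
    inferInstanceAs (Countable (τ.Relations k ⊕ orbitFamily G k))
  infer_instance

instance isRelational_familyLanguage (F : (n : ℕ) → Set (Set (Fin n → ℕ))) :
    (familyLanguage F).IsRelational :=
  fun _ => inferInstanceAs (IsEmpty Empty)

/-- A permutation that preserves all orbits of finite tuples under a closed group lies in it. -/
theorem mem_of_forall_mem_tupleOrbit (hG : IsClosed[permTopology] (G : Set (Equiv.Perm ℕ)))
    {g : Equiv.Perm ℕ} (hg : ∀ (n : ℕ) (a : Fin n → ℕ), (fun i => g (a i)) ∈ tupleOrbit G a) :
    g ∈ G := by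
  let := permTopology
  have hcl : g ∈ closure (G : Set (Equiv.Perm ℕ)) := by
    rw [closure_induced, mem_closure_iff_seq_limit]
    -- `h n` in `G` agrees with `g` below `n`, so `h n` converges pointwise to `g`.
    choose h hh hhg using fun n : ℕ => hg n fun i => i
    refine ⟨fun n => h n, fun n => ⟨h n, hh n, rfl⟩, tendsto_pi_nhds.2 fun k => ?_⟩
    refine tendsto_const_nhds.congr' ?_
    filter_upwards [Filter.eventually_gt_atTop k] with n hn
    exact (congrFun (hhg n) ⟨k, hn⟩).symm
  rwa [hG.closure_eq] at hcl

theorem mem_tupleOrbit_apply_iff {g : Equiv.Perm ℕ} (hg : g ∈ G) {n : ℕ} (a x : Fin n → ℕ) :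
    (fun i => g (x i)) ∈ tupleOrbit G a ↔ x ∈ tupleOrbit G a := by
  constructor
  · rintro ⟨h, hh, e⟩
    refine ⟨g⁻¹ * h, G.mul_mem (G.inv_mem hg) hh, funext fun i => ?_⟩
    simp [show h (a i) = g (x i) from congrFun e i]
  · rintro ⟨h, hh, rfl⟩
    exact ⟨g * h, G.mul_mem hg hh, rfl⟩

/-- The expansion of a structure on `ℕ` by the orbits of `G` on finite tuples. -/
@[reducible] def orbitExpansion (G : Subgroup (Equiv.Perm ℕ)) (M : τ.Structure ℕ) :
    (τ.sum (familyLanguage (orbitFamily G))).Structure ℕ :=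
  letI := M
  letI := familyStructure (orbitFamily G)
  inferInstance

/-- The isomorphisms of orbit expansions are the isomorphisms that belong to the group. -/
theorem nonempty_equiv_orbitExpansion_iff [τ.IsRelational]
    (hG : IsClosed[permTopology] (G : Set (Equiv.Perm ℕ))) (M N : τ.Structure ℕ) :
    Nonempty (@Language.Equiv (τ.sum (familyLanguage (orbitFamily G))) ℕ ℕ
      (orbitExpansion G M) (orbitExpansion G N)) ↔ ∃ g ∈ G, imageStructure g M = N := by
  constructor
  · rintro ⟨e⟩
    let g : Equiv.Perm ℕ := @Language.Equiv.toEquiv _ _ _ (_) (_) e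
    have hg : ∀ {n : ℕ} (R : (τ.sum (familyLanguage (orbitFamily G))).Relations n) (x : Fin n → ℕ),
        (orbitExpansion G N).RelMap R (g ∘ x) ↔ (orbitExpansion G M).RelMap R x :=
      @Language.Equiv.map_rel' _ _ _ (_) (_) e
    refine ⟨g, mem_of_forall_mem_tupleOrbit hG fun n a => ?_, ?_⟩
    -- The tuple `a` lies in its own orbit, whose symbol the isomorphism preserves.
    · exact (hg (Sum.inr ⟨tupleOrbit G a, a, rfl⟩) a).2 ⟨1, G.one_mem, rfl⟩
    · refine Language.Structure.ext (funext fun n => funext fun f => isEmptyElim f)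
        (funext fun n => funext fun R => funext fun x => propext ?_)
      have := hg (Sum.inl R) (g.symm ∘ x)
      rw [← Function.comp_assoc, Equiv.self_comp_symm, Function.id_comp] at this
      exact this.symm
  · rintro ⟨g, hg, rfl⟩
    refine ⟨@Language.Equiv.mk _ _ _ (_) (_) g (fun f => isEmptyElim f) ?_⟩
    rintro n (R | ⟨_, a, rfl⟩) x
    · change M.RelMap R (g.symm ∘ g ∘ x) ↔ M.RelMap R x
      rw [← Function.comp_assoc, Equiv.symm_comp_self, Function.id_comp]
    · exact mem_tupleOrbit_apply_iff hg a x

theorem exists_relative_scottSentence [τ.IsRelational] [Countable τ.Symbols]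
    (hG : IsClosed[permTopology] (G : Set (Equiv.Perm ℕ))) (M : τ.Structure ℕ) :
    ∃ φ : FamilySentence τ (orbitFamily G), ∀ N : τ.Structure ℕ,
      FamilySentence.Holds N φ ↔ ∃ g ∈ G, imageStructure g M = N :=
  ⟨@InfFormula.scottSentence _ ℕ (orbitExpansion G M) _ _, fun N =>
    (@InfFormula.realize_scottSentence_iff_nonempty_equiv _ _ _ ℕ ℕ (orbitExpansion G M)
      (orbitExpansion G N) _ _ _ _ Fin.elim0).trans (nonempty_equiv_orbitExpansion_iff hG M N)⟩

theorem imageStructure_one (M : τ.Structure ℕ) : imageStructure 1 M = M :=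
  Language.Structure.ext rfl rfl

theorem imageStructure_mul (g h : Equiv.Perm ℕ) (M : τ.Structure ℕ) :
    imageStructure (g * h) M = imageStructure g (imageStructure h M) :=
  Language.Structure.ext rfl rfl

variable (τ G) in
/-- The orbit equivalence relation of `G` on the structures with universe `ℕ`. -/
def structureOrbitSetoid : Setoid (τ.Structure ℕ) where
  r M N := ∃ g ∈ G, imageStructure g M = N
  iseqv :=
    { refl := fun M => ⟨1, G.one_mem, imageStructure_one M⟩
      symm := by
        rintro M _ ⟨g, hg, rfl⟩
        exact ⟨g⁻¹, G.inv_mem hg, by rw [← imageStructure_mul, inv_mul_cancel, imageStructure_one]⟩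
      trans := by
        rintro M _ _ ⟨g, hg, rfl⟩ ⟨h, hh, rfl⟩
        exact ⟨h * g, G.mul_mem hh hg, imageStructure_mul h g M⟩ }

end Relative

theorem proposition5 (τ : FirstOrder.Language) [τ.IsRelational] [Countable τ.Symbols]
    (G : Subgroup (Equiv.Perm ℕ)) (hG : IsClosed[permTopology] (G : Set (Equiv.Perm ℕ))) :
    ∃ φ : τ.Structure ℕ → FamilySentence τ (orbitFamily G),
      (∀ M : τ.Structure ℕ, FamilySentence.Holds M (φ M)) ∧
      (∀ M N : τ.Structure ℕ, φ M = φ N ↔ ∃ g ∈ G, imageStructure g M = N) ∧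
      (∀ M N : τ.Structure ℕ, FamilySentence.Holds N (φ M) ↔ ∃ g ∈ G, imageStructure g M = N) := by
  let S := structureOrbitSetoid τ G
  choose σ hσ using exists_relative_scottSentence (τ := τ) hG
  let φ : τ.Structure ℕ → FamilySentence τ (orbitFamily G) := fun M =>
    -- Sentences chosen for two structures in one orbit need not coincide literally; using the
    -- sentence of a fixed orbit representative forces the syntactic equality.
    σ (Quotient.out (Quotient.mk S M))
  have hφ : ∀ M N, FamilySentence.Holds N (φ M) ↔ ∃ g ∈ G, imageStructure g M = N := fun M N =>
    (hσ _ N).trans ⟨fun h => S.trans (S.symm (Quotient.mk_out M)) h,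
      fun h => S.trans (Quotient.mk_out M) h⟩
  have hself : ∀ M, FamilySentence.Holds M (φ M) := fun M => (hφ M M).2 (S.refl M)
  refine ⟨φ, hself, fun M N => ⟨fun h => ?_, fun h => ?_⟩, hφ⟩
  · exact (hφ M N).1 (h ▸ hself N)
  · exact congrArg (fun q => σ (Quotient.out q)) (Quotient.sound (s := S) h)
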